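/- Let $G$ be a locally compact (Hausdorff) topological group, acting on functions by left translation, $(gf)(x)=f(g^{-1}x)$. Let $E=\mathcal{C}^b_{ru}(G)$ be the Banach space of bounded right-uniformly continuous functions $f:G\to\mathbf{R}$, i.e. the bounded continuous functions such that for every $\varepsilon>0$ there is a neighbourhood $U$ of the identity with $|f(ux)-f(x)|<\varepsilon$ for all $u\in U$, $x\in G$; write $f\in E_+$ if $f\in E$ and $f\ge 0$ pointwise. Let $\mathcal{M}_{00}(G)_+$ be the set of finite positive regular Borel measures on $G$ with compact support, and $\mathcal{M}^1_{00}(G)$ the set of probability measures in it. For $\lambda\in\mathcal{M}_{00}(G)_+$ and $f\in E$ put $(\lambda*f)(g)=\int_G f(x^{-1}g)\,d\lambda(x)$. For non-zero $f\in E_+$ define $$(E,f)=\Big\{h\in E:\ |h|\le \sum_{j=1}^n t_j\,g_jf \text{ for some } n\in\mathbf{N},\ t_1,\dots,t_n\ge 0,\ g_1,\dots,g_n\in G\Big\},$$ $$(E,f)_{\mathcal{M}}=\Big\{h\in E:\ |h|\le \lambda*f \text{ for some } \lambda\in\mathcal{M}_{00}(G)_+\Big\}.$$ These are linear subspaces of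 $E$ containing $f$; the first is invariant under left translations, and the second is invariant under convolution by elements of $\mathcal{M}^1_{00}(G)$. Suppose that $G$ has the invariant normalized integral property for $\mathcal{C}^b_{ru}(G)$: for every non-zero $f\in E_+$ there is a positive linear functional $\mathrm{I}$ on $(E,f)$ with $\mathrm{I}(f)=1$ and $\mathrm{I}(gh)=\mathrm{I}(h)$ for all $g\in G$ and $h\in (E,f)$. Then $G$ has the measurably invariant normalized integral property for $\mathcal{C}^b_{ru}(G)$: for every non-zero $f\in E_+$ there is a positive linear functional $\overline{\mathrm{I}}$ on $(E,f)_{\mathcal{M}}$ with $\overline{\mathrm{I}}(f)=1$ and $\overline{\mathrm{I}}(\lambda*h)=\overline{\mathrm{I}}(h)$ for all $\lambda\in\mathcal{M}^1_{00}(G)$ and $h\in (E,f)_{\mathcal{M}}$. -/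

import Mathlib

namespace NormInt

open MeasureTheory Filter Topology Set
open scoped BoundedContinuousFunction CompactlySupported Pointwise

/-! ### Right-uniformly continuous bounded functions -/

section RUC

variable (G : Type*) [Group G] [TopologicalSpace G] [IsTopologicalGroup G]

/-- The space of bounded right-uniformly continuous real functions on `G`: the bounded continuous
functions which are uniformly continuous for the right uniformity of `G` (`x` and `y` are close when
`y * x⁻¹` is close to `1`). By `mem_RUC_iff`, these are the `f` whose left translates depend
norm-continuously on the translating element. -/
def RUC : Submodule ℝ (G →ᵇ ℝ) where
  carrier := {f | @UniformContinuous G ℝ (IsTopologicalGroup.rightUniformSpace G) _ f}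
  add_mem' := by
    intro f g hf hg
    let _ := IsTopologicalGroup.rightUniformSpace G
    exact UniformContinuous.add hf hg
  zero_mem' := by
    let _ := IsTopologicalGroup.rightUniformSpace G
    exact uniformContinuous_const
  smul_mem' := by
    intro c f hf
    let _ := IsTopologicalGroup.rightUniformSpace G
    exact UniformContinuous.const_smul hf c

variable {G}

theorem mem_RUC_iff (f : G →ᵇ ℝ) :
    f ∈ RUC G ↔ ∀ ε > 0, ∀ᶠ u in 𝓝 (1 : G), ∀ x, |f (u * x) - f x| < ε := by
  have h0 : f ∈ RUC G ↔
      Tendsto (fun p : G × G => (f p.1, f p.2)) (comap (fun p : G × G => p.2 * p.1⁻¹) (𝓝 1))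
        (uniformity ℝ) := Iff.rfl
  rw [h0, Metric.uniformity_basis_dist.tendsto_right_iff]
  refine forall₂_congr fun ε _ => ?_
  rw [eventually_comap]
  refine eventually_congr (Eventually.of_forall fun u => ?_)
  constructor
  · intro h x
    have := h (x, u * x) (by simp)
    rwa [Set.mem_ofPred_eq, dist_comm, Real.dist_eq] at this
  · rintro h ⟨x, y⟩ rfl
    have := h x
    rw [Set.mem_ofPred_eq, dist_comm, Real.dist_eq]
    simpa using this

/-- The left translate `g f`, that is `x ↦ f (g⁻¹ x)`. -/
noncomputable def translate (g : G) (f : RUC G) : RUC G :=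
  ⟨(f : G →ᵇ ℝ).compContinuous ⟨fun x => g⁻¹ * x, by fun_prop⟩, by
    rw [mem_RUC_iff]
    intro ε hε
    have h := (mem_RUC_iff _).1 f.2 ε hε
    have hc : Tendsto (fun u : G => g⁻¹ * u * g) (𝓝 1) (𝓝 1) := by
      have : Continuous fun u : G => g⁻¹ * u * g := by fun_prop
      simpa using this.tendsto 1
    filter_upwards [hc.eventually h] with u hu x
    simpa [mul_assoc] using hu (g⁻¹ * x)⟩

@[simp] theorem translate_apply (g : G) (f : RUC G) (x : G) :
    (translate g f : G →ᵇ ℝ) x = (f : G →ᵇ ℝ) (g⁻¹ * x) := rfl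

/-- The ideal `(E, f)` of all `h ∈ E` with `|h| ≤ ∑ tⱼ (gⱼ f)` for finitely many `gⱼ ∈ G` and real
numbers `tⱼ ≥ 0`, where `E = RUC G`. -/
def dominated (f : RUC G) : Submodule ℝ (RUC G) where
  carrier := {h | ∃ (n : ℕ) (t : Fin n → ℝ) (g : Fin n → G), (∀ j, 0 ≤ t j) ∧
    ∀ x, |(h : G →ᵇ ℝ) x| ≤ ∑ j, t j * (translate (g j) f : G →ᵇ ℝ) x}
  add_mem' := by
    rintro h k ⟨n, t, g, ht, hh⟩ ⟨m, s, l, hs, hk⟩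
    refine ⟨n + m, Fin.append t s, Fin.append g l, fun j => ?_, fun x => ?_⟩
    · refine Fin.addCases (fun i => ?_) (fun i => ?_) j
      · simpa using ht i
      · simpa using hs i
    · rw [Fin.sum_univ_add]
      simp only [Fin.append_left, Fin.append_right]
      exact (abs_add_le _ _).trans (add_le_add (hh x) (hk x))
  zero_mem' := ⟨0, Fin.elim0, Fin.elim0, fun j => j.elim0, fun x => by simp⟩
  smul_mem' := by
    rintro c h ⟨n, t, g, ht, hh⟩
    refine ⟨n, fun j => |c| * t j, g, fun j => mul_nonneg (abs_nonneg c) (ht j), fun x => ?_⟩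
    have : ((c • h : RUC G) : G →ᵇ ℝ) x = c * (h : G →ᵇ ℝ) x := rfl
    rw [this, abs_mul]
    simp only [mul_assoc, ← Finset.mul_sum]
    exact mul_le_mul_of_nonneg_left (hh x) (abs_nonneg c)

theorem self_mem_dominated {f : RUC G} (hf : ∀ x, 0 ≤ (f : G →ᵇ ℝ) x) : f ∈ dominated f :=
  ⟨1, fun _ => 1, fun _ => 1, fun _ => zero_le_one, fun x => by simp [abs_of_nonneg (hf x)]⟩

theorem translate_mem_dominated {f h : RUC G} (a : G) (hh : h ∈ dominated f) :
    translate a h ∈ dominated f := by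
  obtain ⟨n, t, g, ht, hh⟩ := hh
  refine ⟨n, t, fun j => a * g j, ht, fun x => ?_⟩
  simpa [mul_assoc] using hh (a⁻¹ * x)

variable (G) in
/-- `G` has the invariant normalized integral property for `RUC G`: for every non-zero `f ≥ 0`
there is a positive linear functional `I` on `(E, f)`, invariant under left translations, with
`I f = 1`. -/
def InvariantNormalizedIntegralProperty : Prop :=
  ∀ (f : RUC G) (hf : ∀ x, 0 ≤ (f : G →ᵇ ℝ) x), f ≠ 0 →
    ∃ I : dominated f →ₗ[ℝ] ℝ,
      (∀ h : dominated f, (∀ x, 0 ≤ ((h : RUC G) : G →ᵇ ℝ) x) → 0 ≤ I h) ∧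
      (∀ (g : G) (h : dominated f),
        I ⟨translate g h, translate_mem_dominated g h.2⟩ = I h) ∧
      I ⟨f, self_mem_dominated hf⟩ = 1

end RUC

/-! ### Compactly supported regular measures and their action by convolution -/

section Measures

variable {G : Type*} [Group G] [TopologicalSpace G] [IsTopologicalGroup G]
  [MeasurableSpace G] [BorelSpace G]

/-- Positive finite regular Borel measures with compact support. -/
structure IsM00Pos (μ : Measure G) : Prop where
  finite : IsFiniteMeasure μ
  regular : μ.Regular
  isCompact_support : IsCompact μ.support

/-- Regular Borel probability measures with compact support. -/
structure IsM001 (μ : Measure G) : Prop extends IsM00Pos μ where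
  measure_univ : μ Set.univ = 1

theorem IsM00Pos.ae_mem {μ : Measure G} (hμ : IsM00Pos μ) : ∀ᵐ x ∂μ, x ∈ μ.support :=
  have := hμ.regular
  Measure.support_mem_ae_of_regular

theorem IsM00Pos.integrable {μ : Measure G} (hμ : IsM00Pos μ) {f : G → ℝ} (hf : Continuous f) :
    Integrable f μ := by
  have := hμ.finite
  obtain ⟨C, hC⟩ := hμ.isCompact_support.exists_bound_of_continuousOn hf.continuousOn
  exact Integrable.of_bound hf.aestronglyMeasurable C (hμ.ae_mem.mono hC)

theorem isM00Pos_dirac [T2Space G] [LocallyCompactSpace G] (a : G) :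
    IsM00Pos (Measure.dirac a) where
  finite := inferInstance
  regular := by
    have : (Measure.dirac a).OuterRegular := by
      refine ⟨fun A hA r hr => ?_⟩
      by_cases h : a ∈ A
      · refine ⟨Set.univ, subset_univ _, isOpen_univ, ?_⟩
        rw [Measure.dirac_apply' _ hA] at hr
        simpa [h] using hr
      · refine ⟨{a}ᶜ, by simpa using h, isOpen_compl_singleton, ?_⟩
        rw [Measure.dirac_apply' _ isOpen_compl_singleton.measurableSet]
        simpa using pos_of_gt hr
    refine ⟨fun U hU r hr => ?_⟩
    by_cases h : a ∈ U
    · refine ⟨{a}, by simpa using h, isCompact_singleton, ?_⟩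
      rw [Measure.dirac_apply' _ hU.measurableSet] at hr
      simpa [h] using hr
    · rw [Measure.dirac_apply' _ hU.measurableSet] at hr
      simp [h] at hr
  isCompact_support := by
    refine (isCompact_singleton (x := a)).of_isClosed_subset Measure.isClosed_support ?_
    refine Measure.support_subset_of_isClosed isClosed_singleton ?_
    rw [mem_ae_iff, Measure.dirac_apply' _ isOpen_compl_singleton.measurableSet]
    simp

theorem IsM00Pos.smul {μ : Measure G} (hμ : IsM00Pos μ) (c : NNReal) : IsM00Pos (c • μ) where
  finite := have := hμ.finite; inferInstance
  regular := have := hμ.regular; inferInstance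
  isCompact_support := hμ.isCompact_support.of_isClosed_subset Measure.isClosed_support
    (Measure.AbsolutelyContinuous.support_mono Measure.smul_absolutelyContinuous)

theorem IsM00Pos.continuous_integral [T2Space G] [LocallyCompactSpace G] {X : Type*}
    [TopologicalSpace X] {μ : Measure G} (hμ : IsM00Pos μ) {F : X → G → ℝ}
    (hF : Continuous (Function.uncurry F)) : Continuous fun x => ∫ y, F x y ∂μ := by
  have := hμ.finite
  obtain ⟨χ, h1, hc, -, -⟩ := exists_continuousMap_one_of_isCompact_subset_isOpen
    hμ.isCompact_support isOpen_univ (subset_univ _)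
  have key : ∀ x, ∫ y, F x y ∂μ = ∫ y, F x y * χ y ∂μ := fun x =>
    integral_congr_ae (hμ.ae_mem.mono fun y hy => by simp [h1 hy])
  simp_rw [key, ← continuousOn_univ]
  refine continuousOn_integral_of_compact_support hc ?_ ?_
  · have : Continuous (Function.uncurry fun x y => F x y * χ y) :=
      hF.mul (χ.continuous.comp continuous_snd)
    exact this.continuousOn
  · intro p y _ hy
    simp [image_eq_zero_of_notMem_tsupport hy]

/-- A positive linear functional on compactly supported continuous functions that only depends on
the values on a compact set is given by a compactly supported regular measure. -/
theorem exists_isM00Pos [T2Space G] [LocallyCompactSpace G] (Λ : C_c(G, ℝ) →ₗ[ℝ] ℝ)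
    (hpos : ∀ ψ, 0 ≤ ψ → 0 ≤ Λ ψ) {L : Set G} (hL : IsCompact L)
    (hΛ : ∀ ψ : C_c(G, ℝ), (∀ x ∈ L, ψ x = 0) → Λ ψ = 0) :
    ∃ ρ : Measure G, IsM00Pos ρ ∧ ∀ (f : G → ℝ), Continuous f →
      ∃ ψ : C_c(G, ℝ), (∀ x ∈ L, ψ x = f x) ∧ ∫ x, f x ∂ρ = Λ ψ := by
  let Λ' : C_c(G, ℝ) →ₚ[ℝ] ℝ := PositiveLinearMap.mk₀ Λ hpos
  let ρ := RealRMK.rieszMeasure Λ'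
  have hcompl : ρ Lᶜ = 0 := by
    by_contra hne
    obtain ⟨K, hKL, hK, hKpos⟩ := Measure.Regular.innerRegular (μ := ρ) hL.isClosed.isOpen_compl 0
      (pos_iff_ne_zero.2 hne)
    obtain ⟨χ, h1, h0, hc, hχ⟩ := exists_continuous_one_zero_of_isCompact hK hL.isClosed
      (disjoint_left.2 fun x hx hx' => hKL hx hx')
    have := RealRMK.rieszMeasure_le_of_eq_one Λ' (f := ⟨χ, hc⟩) (fun x => (hχ x).1) hK
      (fun x hx => h1 hx)
    have hz : Λ' ⟨χ, hc⟩ = 0 := hΛ _ fun x hx => h0 hx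
    rw [hz, ENNReal.ofReal_zero] at this
    exact absurd hKpos (not_lt.2 this)
  have hreg : ρ.Regular := inferInstance
  have hfin : IsFiniteMeasure ρ := by
    refine ⟨?_⟩
    rw [← Set.union_compl_self L]
    refine (measure_union_le _ _).trans_lt ?_
    rw [hcompl, add_zero]
    exact hL.measure_lt_top
  refine ⟨ρ, ⟨hfin, hreg, hL.of_isClosed_subset Measure.isClosed_support
    (Measure.support_subset_of_isClosed hL.isClosed hcompl)⟩, fun f hf => ?_⟩
  obtain ⟨χ, h1, hc, -, -⟩ := exists_continuousMap_one_of_isCompact_subset_isOpen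
    hL isOpen_univ (subset_univ _)
  have hc' : HasCompactSupport χ := hc
  refine ⟨⟨⟨fun x => χ x * f x, by fun_prop⟩, hc'.mul_right⟩, fun x hx => ?_, ?_⟩
  · change χ x * f x = f x
    simp [h1 hx]
  · refine Eq.trans ?_ (RealRMK.integral_rieszMeasure Λ' _)
    have hae : ∀ᵐ x ∂ρ, x ∈ L := hcompl
    refine integral_congr_ae (hae.mono fun x hx => ?_)
    change f x = χ x * f x
    simp [h1 hx]

theorem IsM00Pos.exists_add [T2Space G] [LocallyCompactSpace G] {μ ν : Measure G}
    (hμ : IsM00Pos μ) (hν : IsM00Pos ν) : ∃ ρ : Measure G, IsM00Pos ρ ∧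
      ∀ f : G → ℝ, Continuous f → ∫ x, f x ∂ρ = ∫ x, f x ∂μ + ∫ x, f x ∂ν := by
  let Λ : C_c(G, ℝ) →ₗ[ℝ] ℝ :=
    { toFun := fun ψ => ∫ x, ψ x ∂μ + ∫ x, ψ x ∂ν
      map_add' := fun φ ψ => by
        have h1 : ∫ x, (φ + ψ) x ∂μ = ∫ x, φ x ∂μ + ∫ x, ψ x ∂μ :=
          integral_add (hμ.integrable φ.continuous) (hμ.integrable ψ.continuous)
        have h2 : ∫ x, (φ + ψ) x ∂ν = ∫ x, φ x ∂ν + ∫ x, ψ x ∂ν :=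
          integral_add (hν.integrable φ.continuous) (hν.integrable ψ.continuous)
        rw [h1, h2]
        ring
      map_smul' := fun c ψ => by
        simp only [CompactlySupportedContinuousMap.coe_smul, Pi.smul_apply, smul_eq_mul,
          integral_const_mul, RingHom.id_apply]
        ring }
  have hL := hμ.isCompact_support.union hν.isCompact_support
  obtain ⟨ρ, hρ, h⟩ := exists_isM00Pos Λ
    (fun ψ hψ => add_nonneg (integral_nonneg hψ) (integral_nonneg hψ)) hL (fun ψ hψ => by
      change ∫ x, ψ x ∂μ + ∫ x, ψ x ∂ν = 0
      rw [integral_eq_zero_of_ae (hμ.ae_mem.mono fun x hx => hψ x (Or.inl hx)),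
        integral_eq_zero_of_ae (hν.ae_mem.mono fun x hx => hψ x (Or.inr hx)), add_zero])
  refine ⟨ρ, hρ, fun f hf => ?_⟩
  obtain ⟨ψ, hψ, he⟩ := h f hf
  rw [he]
  change ∫ x, ψ x ∂μ + ∫ x, ψ x ∂ν = _
  rw [integral_congr_ae (hμ.ae_mem.mono fun x hx => hψ x (Or.inl hx)),
    integral_congr_ae (hν.ae_mem.mono fun x hx => hψ x (Or.inr hx))]

theorem IsM00Pos.exists_conv [T2Space G] [LocallyCompactSpace G] {μ ν : Measure G}
    (hμ : IsM00Pos μ) (hν : IsM00Pos ν) : ∃ ρ : Measure G, IsM00Pos ρ ∧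
      ∀ f : G → ℝ, Continuous f → ∫ z, f z ∂ρ = ∫ x, ∫ y, f (x * y) ∂ν ∂μ := by
  have hint : ∀ f : G → ℝ, Continuous f → Continuous fun x => ∫ y, f (x * y) ∂ν := fun f hf =>
    hν.continuous_integral (F := fun x y => f (x * y)) (hf.comp continuous_mul)
  have hintν : ∀ f : G → ℝ, Continuous f → ∀ x, Integrable (fun y => f (x * y)) ν := fun f hf x =>
    hν.integrable (hf.comp (continuous_const_mul x))
  let Λ : C_c(G, ℝ) →ₗ[ℝ] ℝ :=
    { toFun := fun ψ => ∫ x, ∫ y, ψ (x * y) ∂ν ∂μ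
      map_add' := fun φ ψ => by
        rw [← integral_add (hμ.integrable (hint φ φ.continuous))
          (hμ.integrable (hint ψ ψ.continuous))]
        refine integral_congr_ae (Eventually.of_forall fun x => ?_)
        exact integral_add (hintν φ φ.continuous x) (hintν ψ ψ.continuous x)
      map_smul' := fun c ψ => by
        simp only [CompactlySupportedContinuousMap.coe_smul, Pi.smul_apply, smul_eq_mul,
          integral_const_mul, RingHom.id_apply] }
  have hL := hμ.isCompact_support.mul hν.isCompact_support
  have hcongr : ∀ f k : G → ℝ, (∀ z ∈ μ.support * ν.support, f z = k z) →
      ∫ x, ∫ y, f (x * y) ∂ν ∂μ = ∫ x, ∫ y, k (x * y) ∂ν ∂μ := fun f k h =>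
    integral_congr_ae (hμ.ae_mem.mono fun x hx =>
      integral_congr_ae (hν.ae_mem.mono fun y hy => h _ (Set.mul_mem_mul hx hy)))
  obtain ⟨ρ, hρ, h⟩ := exists_isM00Pos Λ
    (fun ψ hψ => integral_nonneg fun x => integral_nonneg fun y => hψ _) hL (fun ψ hψ => by
      refine (hcongr ψ (fun _ => 0) hψ).trans ?_
      simp)
  refine ⟨ρ, hρ, fun f hf => ?_⟩
  obtain ⟨ψ, hψ, he⟩ := h f hf
  rw [he]
  exact hcongr _ _ hψ

/-- The convolution `(μ * f) (g) = ∫ f (x⁻¹ g) dμ(x)` of a measure and a function. -/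
noncomputable def convFun (μ : Measure G) (f : G → ℝ) (g : G) : ℝ := ∫ x, f (x⁻¹ * g) ∂μ

theorem continuous_translates (f : RUC G) (g : G) :
    Continuous fun x : G => (f : G →ᵇ ℝ) (x⁻¹ * g) :=
  (f : G →ᵇ ℝ).continuous.comp (by fun_prop)

variable [T2Space G] [LocallyCompactSpace G]

/-- The convolution `μ * f` as an element of `RUC G`, for `f` in `RUC G` and `μ` a positive
compactly supported regular measure. -/
noncomputable def conv (μ : Measure G) (hμ : IsM00Pos μ) (f : RUC G) : RUC G :=
  ⟨BoundedContinuousFunction.ofNormedAddCommGroup (convFun μ (f : G →ᵇ ℝ))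
    (hμ.continuous_integral (F := fun g x => (f : G →ᵇ ℝ) (x⁻¹ * g))
      ((f : G →ᵇ ℝ).continuous.comp (by fun_prop)))
    (‖(f : G →ᵇ ℝ)‖ * μ.real univ)
    (fun g => by
      have := hμ.finite
      exact norm_integral_le_of_norm_le_const
        (Eventually.of_forall fun x => (f : G →ᵇ ℝ).norm_coe_le_norm _)), by
    have := hμ.finite
    rw [mem_RUC_iff]
    intro ε hε
    have hM : 0 < μ.real univ + 1 := by positivity
    have h := (mem_RUC_iff _).1 f.2 (ε / (μ.real univ + 1)) (by positivity)
    have h2 : ∀ᶠ u in 𝓝 (1 : G), ∀ y ∈ μ.support, ∀ x,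
        |(f : G →ᵇ ℝ) (y⁻¹ * u * y * x) - (f : G →ᵇ ℝ) x| < ε / (μ.real univ + 1) := by
      refine hμ.isCompact_support.eventually_forall_of_forall_eventually fun y _ => ?_
      have hc : Continuous fun p : G × G => p.2⁻¹ * p.1 * p.2 := by fun_prop
      have ht : Tendsto (fun p : G × G => p.2⁻¹ * p.1 * p.2) (𝓝 (1, y)) (𝓝 1) := by
        simpa using hc.tendsto (1, y)
      exact ht.eventually h
    filter_upwards [h2] with u hu g
    change |(∫ x, (f : G →ᵇ ℝ) (x⁻¹ * (u * g)) ∂μ) - ∫ x, (f : G →ᵇ ℝ) (x⁻¹ * g) ∂μ| < ε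
    rw [← integral_sub (hμ.integrable (continuous_translates f _))
      (hμ.integrable (continuous_translates f _)), ← Real.norm_eq_abs]
    have hb : ∀ᵐ y ∂μ, ‖(f : G →ᵇ ℝ) (y⁻¹ * (u * g)) - (f : G →ᵇ ℝ) (y⁻¹ * g)‖
        ≤ ε / (μ.real univ + 1) := hμ.ae_mem.mono fun y hy => by
      have := (hu y hy (y⁻¹ * g)).le
      simpa [mul_assoc] using this
    refine (norm_integral_le_of_norm_le_const hb).trans_lt ?_
    rw [div_mul_eq_mul_div, div_lt_iff₀ hM]
    nlinarith⟩

@[simp] theorem conv_apply (μ : Measure G) (hμ : IsM00Pos μ) (f : RUC G) (g : G) :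
    (conv μ hμ f : G →ᵇ ℝ) g = ∫ x, (f : G →ᵇ ℝ) (x⁻¹ * g) ∂μ := rfl

/-- The ideal `(E, f)_M` of all `h ∈ E` with `|h| ≤ μ * f` for some positive compactly supported
regular measure `μ`, where `E = RUC G`. -/
def measureDominated (f : RUC G) : Submodule ℝ (RUC G) where
  carrier := {h | ∃ (μ : Measure G) (hμ : IsM00Pos μ),
    ∀ x, |(h : G →ᵇ ℝ) x| ≤ (conv μ hμ f : G →ᵇ ℝ) x}
  add_mem' := by
    rintro h k ⟨μ, hμ, hh⟩ ⟨ν, hν, hk⟩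
    obtain ⟨ρ, hρ, he⟩ := hμ.exists_add hν
    refine ⟨ρ, hρ, fun x => ?_⟩
    rw [conv_apply, he _ (continuous_translates f x)]
    exact (abs_add_le _ _).trans (add_le_add (hh x) (hk x))
  zero_mem' := by
    refine ⟨0, ⟨inferInstance, inferInstance, by simp⟩, fun x => by simp⟩
  smul_mem' := by
    rintro c h ⟨μ, hμ, hh⟩
    refine ⟨‖c‖₊ • μ, hμ.smul _, fun x => ?_⟩
    have : ((c • h : RUC G) : G →ᵇ ℝ) x = c * (h : G →ᵇ ℝ) x := rfl
    rw [this, abs_mul, conv_apply, integral_smul_nnreal_measure]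
    exact mul_le_mul_of_nonneg_left (hh x) (abs_nonneg c)

theorem self_mem_measureDominated {f : RUC G} (hf : ∀ x, 0 ≤ (f : G →ᵇ ℝ) x) :
    f ∈ measureDominated f :=
  ⟨Measure.dirac 1, isM00Pos_dirac 1, fun x => by
    rw [conv_apply, integral_dirac' _ _ (continuous_translates f x).stronglyMeasurable]
    simp [abs_of_nonneg (hf x)]⟩

theorem conv_mem_measureDominated {f h : RUC G} {ν : Measure G} (hν : IsM00Pos ν)
    (hh : h ∈ measureDominated f) : conv ν hν h ∈ measureDominated f := by
  obtain ⟨μ, hμ, hh⟩ := hh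
  obtain ⟨ρ, hρ, he⟩ := hν.exists_conv hμ
  refine ⟨ρ, hρ, fun g => ?_⟩
  rw [conv_apply, conv_apply, he _ (continuous_translates f g)]
  refine abs_integral_le_integral_abs.trans (integral_mono
    (hν.integrable (continuous_translates h g).abs) (hν.integrable ?_) fun x => ?_)
  · exact hμ.continuous_integral (F := fun x y => (f : G →ᵇ ℝ) ((x * y)⁻¹ * g))
      ((f : G →ᵇ ℝ).continuous.comp (by fun_prop))
  · have := hh (x⁻¹ * g)
    rw [conv_apply] at this
    simpa [mul_assoc] using this

variable (G) in
/-- `G` has the measurably invariant normalized integral property for `RUC G`: for every non-zero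
`f ≥ 0` there is a positive linear functional `I` on `(E, f)_M`, invariant under convolution by all
compactly supported regular Borel probability measures, with `I f = 1`. -/
def MeasurablyInvariantNormalizedIntegralProperty : Prop :=
  ∀ (f : RUC G) (hf : ∀ x, 0 ≤ (f : G →ᵇ ℝ) x), f ≠ 0 →
    ∃ I : measureDominated f →ₗ[ℝ] ℝ,
      (∀ h : measureDominated f, (∀ x, 0 ≤ ((h : RUC G) : G →ᵇ ℝ) x) → 0 ≤ I h) ∧
      (∀ (μ : Measure G) (hμ : IsM001 μ) (h : measureDominated f),
        I ⟨conv μ hμ.toIsM00Pos h, conv_mem_measureDominated hμ.toIsM00Pos h.2⟩ = I h) ∧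
      I ⟨f, self_mem_measureDominated hf⟩ = 1

end Measures

end NormInt

namespace NormInt

open MeasureTheory Filter Topology Set
open scoped BoundedContinuousFunction CompactlySupported Pointwise

/-! ### Compactly supported densities with respect to Haar measure -/

section Smoothing

open Measure

variable {G : Type*} [Group G] [TopologicalSpace G] [IsTopologicalGroup G] [LocallyCompactSpace G]

/-! Smoothing by a fixed density turns invariance under translations into invariance under
convolution by measures. Choose `φ ≥ 0` in `C_c(G)` with `φ 1 ≠ 0`, let `I` be the invariant
integral for `φ * f`, and put `J k = I (φ * k)`, so that `J f = 1`.

`J` is defined on all of `(E, f)_M` (`densityConv_mem_dominated`): if `|k| ≤ μ * f`, then `|φ * k| ≤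
(φ * μ) * f`. The density `φ * μ` is again in `C_c(G)` (`exists_density_conv`), hence lies below a
finite combination of translates of `φ` (`exists_abs_le_sum_translates`).

For invariance, fix `k ≥ 0`. The map `ψ ↦ I (ψ * k)` is a positive left-invariant functional on
`C_c(G)`, hence a multiple of the Haar integral (`exists_eq_mul_integral_haar`). For a probability
measure `μ` the densities `φ * μ` and `φ` have equal Haar integral (`exists_densityConv_conv`), so
`J (μ * k) = J k`. A general `k` is a difference of two non-negative elements of `(E, f)_M`. -/

theorem integrable_density [MeasurableSpace G] [BorelSpace G] (φ : C_c(G, ℝ))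
    {k : G → ℝ} (hk : Continuous k) :
    Integrable (fun x => φ x * k x) haar :=
  (φ.continuous.mul hk).integrable_of_hasCompactSupport φ.hasCompactSupport.mul_right

/-- The image of Haar measure under a right translation is still left invariant, so it is a multiple
of Haar measure; the factor is the modular character. -/
theorem integral_mul_right_eq_of_hasCompactSupport [MeasurableSpace G] [BorelSpace G] (y : G)
    {f : G → ℝ} (hf : Continuous f) (hc : HasCompactSupport f) :
    ∫ x, f (x * y) ∂(haar : Measure G) = modularCharacterFun y * ∫ x, f x ∂(haar : Measure G) := by
  have h := integral_isMulLeftInvariant_eq_smul_of_hasCompactSupport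
    (map (· * y) (haar : Measure G)) haar hf hc
  rw [integral_map (by fun_prop) hf.aestronglyMeasurable, integral_smul_nnreal_measure,
    ← modularCharacterFun_eq_haarScalarFactor] at h
  exact h

/-- The modular character is continuous. -/
theorem continuous_modularCharacterFun :
    Continuous fun y : G => (modularCharacterFun y : ℝ) := by
  borelize G
  obtain ⟨⟨f, hf⟩, hc, h0, h1⟩ : ∃ f : C(G, ℝ), HasCompactSupport f ∧ 0 ≤ f ∧ f 1 ≠ 0 :=
    exists_continuous_nonneg_pos 1
  have hpos : ∫ x, f x ∂(haar : Measure G) ≠ 0 :=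
    (hf.integral_pos_of_hasCompactSupport_nonneg_nonzero hc h0 h1).ne'
  -- Writing the character as a quotient with one fixed `f` reduces the claim to continuity of an
  -- integral in a parameter.
  have heq : (fun y : G => (modularCharacterFun y : ℝ)) =
      fun y => (∫ x, f (x * y) ∂(haar : Measure G)) / ∫ x, f x ∂(haar : Measure G) := by
    ext y
    rw [integral_mul_right_eq_of_hasCompactSupport y hf hc, mul_div_cancel_right₀ _ hpos]
  rw [heq]
  refine Continuous.div_const ?_ _
  rw [continuous_iff_continuousAt]
  intro y₀
  -- For `y ∈ K` all functions `x ↦ f (x * y)` vanish off the single compact set `tsupport f * K⁻¹`.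
  obtain ⟨K, hK, hKy⟩ := exists_compact_mem_nhds y₀
  refine ContinuousOn.continuousAt (s := K) ?_ hKy
  refine continuousOn_integral_of_compact_support (f := fun y x => f (x * y))
    (k := tsupport f * K⁻¹) (IsCompact.mul hc hK.inv) ?_ ?_
  · exact (hf.comp (by fun_prop : Continuous fun p : G × G => p.2 * p.1)).continuousOn
  · intro y x hy hx
    by_contra hne
    refine hx ⟨x * y, subset_tsupport f hne, y⁻¹, by simpa using hy, by group⟩

variable [T2Space G] [MeasurableSpace G] [BorelSpace G]

/-- The convolution of a compactly supported density with a compactly supported measure has a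
compactly supported density. -/
theorem exists_density_conv (φ : C_c(G, ℝ)) {μ : Measure G} (hμ : IsM00Pos μ) :
    ∃ ψ : C_c(G, ℝ), ∀ k : G → ℝ, Continuous k →
      ∫ x, φ x * ∫ y, k (x * y) ∂μ ∂haar = ∫ z, ψ z * k z ∂haar := by
  have := hμ.finite
  -- The cutoff `χ` does not change integrals against `μ`, but makes the integrands compactly
  -- supported on `G × G`, so the integrals can be swapped although Haar measure need not be
  -- σ-finite.
  obtain ⟨χ, h1, hc, -, -⟩ := exists_continuousMap_one_of_isCompact_subset_isOpen
    hμ.isCompact_support isOpen_univ (subset_univ _)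
  have hc' : HasCompactSupport χ := hc
  have hD := continuous_modularCharacterFun (G := G)
  -- Substituting `x * y⁻¹` for `x` in the inner Haar integral produces this kernel; the modular
  -- factor is the cost of the right translation.
  let w : G → G → ℝ := fun x y => χ y * modularCharacterFun y * φ (x * y⁻¹)
  have hw : Continuous (Function.uncurry w) := by
    have h1 : Continuous fun p : G × G => χ p.2 := by fun_prop
    have h2 : Continuous fun p : G × G => (modularCharacterFun p.2 : ℝ) := hD.comp continuous_snd
    have h3 : Continuous fun p : G × G => φ (p.1 * p.2⁻¹) :=
      φ.continuous.comp (by fun_prop : Continuous fun p : G × G => p.1 * p.2⁻¹)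
    exact (h1.mul h2).mul h3
  have hψc : HasCompactSupport fun x => ∫ y, w x y ∂μ := by
    refine HasCompactSupport.intro (IsCompact.mul φ.hasCompactSupport hc') fun x hx => ?_
    refine integral_eq_zero_of_ae (Eventually.of_forall fun y => ?_)
    by_contra hne
    have h3 : χ y ≠ 0 := fun h => hne (by simp [w, h])
    have h4 : φ (x * y⁻¹) ≠ 0 := fun h => hne (by simp [w, h])
    exact hx ⟨x * y⁻¹, subset_tsupport _ h4, y, subset_tsupport _ h3, by group⟩
  refine ⟨⟨⟨fun x => ∫ y, w x y ∂μ, hμ.continuous_integral hw⟩, hψc⟩, fun k hk => ?_⟩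
  have hae : ∀ F : G → ℝ, ∫ y, F y ∂μ = ∫ y, χ y * F y ∂μ := fun F =>
    integral_congr_ae (hμ.ae_mem.mono fun y hy => by simp [h1 hy])
  calc ∫ x, φ x * ∫ y, k (x * y) ∂μ ∂haar
      = ∫ x, ∫ y, φ x * (χ y * k (x * y)) ∂μ ∂haar := by
        refine integral_congr_ae (Eventually.of_forall fun x => ?_)
        simp only [hae (fun y => k (x * y)), integral_const_mul]
    _ = ∫ y, ∫ x, φ x * (χ y * k (x * y)) ∂haar ∂μ := by
        refine integral_integral_swap_of_hasCompactSupport ?_ ?_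
        · have h1 : Continuous fun p : G × G => φ p.1 := φ.continuous.comp continuous_fst
          have h2 : Continuous fun p : G × G => χ p.2 := by fun_prop
          have h3 : Continuous fun p : G × G => k (p.1 * p.2) := hk.comp continuous_mul
          exact h1.mul (h2.mul h3)
        · refine HasCompactSupport.intro (IsCompact.prod φ.hasCompactSupport hc')
            fun p hp => ?_
          by_contra hne
          refine hp ⟨subset_tsupport _ fun h => hne ?_, subset_tsupport _ fun h => hne ?_⟩ <;>
            simp [Function.uncurry, h]
    _ = ∫ y, ∫ x, w x y * k x ∂haar ∂μ := by
        refine integral_congr_ae (Eventually.of_forall fun y => ?_)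
        have hF : Continuous fun x => φ (x * y⁻¹) * k x :=
          (φ.continuous.comp (continuous_mul_const y⁻¹)).mul hk
        have hFc : HasCompactSupport fun x => φ (x * y⁻¹) * k x :=
          (φ.hasCompactSupport.comp_homeomorph (Homeomorph.mulRight y⁻¹)).mul_right
        have h2 := integral_mul_right_eq_of_hasCompactSupport y hF hFc
        simp only [mul_inv_cancel_right] at h2
        simp only [w, mul_assoc, integral_const_mul, ← h2]
        rw [← integral_const_mul]
        exact integral_congr_ae (Eventually.of_forall fun x => by ring)
    _ = ∫ x, ∫ y, w x y * k x ∂μ ∂haar := by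
        refine (integral_integral_swap_of_hasCompactSupport ?_ ?_).symm
        · exact hw.mul (hk.comp continuous_fst)
        · refine HasCompactSupport.intro ((IsCompact.mul φ.hasCompactSupport hc').prod hc')
            fun p hp => ?_
          by_contra hne
          have h3 : χ p.2 ≠ 0 := fun h => hne (by simp [Function.uncurry, w, h])
          have h4 : φ (p.1 * p.2⁻¹) ≠ 0 := fun h => hne (by simp [Function.uncurry, w, h])
          exact hp ⟨⟨p.1 * p.2⁻¹, subset_tsupport _ h4, p.2, subset_tsupport _ h3, by group⟩,
            subset_tsupport _ h3⟩
    _ = ∫ z, (∫ y, w z y ∂μ) * k z ∂haar := by simp only [integral_mul_const]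

/-- A non-negative compactly supported density defines a compactly supported regular measure. -/
theorem exists_isM00Pos_density (φ : C_c(G, ℝ)) (hφ : ∀ x, 0 ≤ φ x) :
    ∃ ρ : Measure G, IsM00Pos ρ ∧ ∀ k : G → ℝ, Continuous k →
      ∫ x, k x ∂ρ = ∫ x, φ x * k x ∂haar := by
  have hint : ∀ ψ : C_c(G, ℝ), Integrable (fun x => φ x * ψ x) haar := fun ψ =>
    integrable_density φ ψ.continuous
  let Λ : C_c(G, ℝ) →ₗ[ℝ] ℝ :=
    { toFun := fun ψ => ∫ x, φ x * ψ x ∂haar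
      map_add' := fun ψ θ => by
        rw [← integral_add (hint ψ) (hint θ)]
        simp [mul_add]
      map_smul' := fun c ψ => by
        simp only [CompactlySupportedContinuousMap.coe_smul, Pi.smul_apply, smul_eq_mul,
          RingHom.id_apply, ← integral_const_mul]
        exact integral_congr_ae (Eventually.of_forall fun x => by ring) }
  have hcongr : ∀ k l : G → ℝ, (∀ x ∈ tsupport φ, k x = l x) →
      ∫ x, φ x * k x ∂haar = ∫ x, φ x * l x ∂haar := fun k l h =>
    integral_congr_ae (Eventually.of_forall fun x => by
      by_cases hx : x ∈ tsupport φ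
      · simp [h x hx]
      · simp [image_eq_zero_of_notMem_tsupport hx])
  obtain ⟨ρ, hρ, h⟩ := exists_isM00Pos Λ
    (fun ψ hψ => integral_nonneg fun x => mul_nonneg (hφ x) (hψ x)) φ.hasCompactSupport
    (fun ψ hψ => (hcongr ψ (fun _ => 0) hψ).trans (by simp))
  refine ⟨ρ, hρ, fun k hk => ?_⟩
  obtain ⟨ψ, hψ, he⟩ := h k hk
  rw [he]
  exact hcongr _ _ hψ

/-- Splitting `φ` into positive and negative parts reduces this to `conv`, which already lands in
`RUC G` but takes positive measures only. -/
theorem exists_densityConv (φ : C_c(G, ℝ)) (h : RUC G) :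
    ∃ k : RUC G, ∀ g, (k : G →ᵇ ℝ) g = ∫ x, φ x * (h : G →ᵇ ℝ) (x⁻¹ * g) ∂haar := by
  obtain ⟨ρ, hρ, hρi⟩ := exists_isM00Pos_density (φ ⊔ 0) fun x => le_sup_right
  obtain ⟨σ, hσ, hσi⟩ := exists_isM00Pos_density (-φ ⊔ 0) fun x => le_sup_right
  refine ⟨conv ρ hρ h - conv σ hσ h, fun g => ?_⟩
  have hg := continuous_translates h g
  change (conv ρ hρ h : G →ᵇ ℝ) g - (conv σ hσ h : G →ᵇ ℝ) g = _
  rw [conv_apply, conv_apply, hρi _ hg, hσi _ hg,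
    ← integral_sub (integrable_density _ hg) (integrable_density _ hg)]
  refine integral_congr_ae (Eventually.of_forall fun x => ?_)
  change max (φ x) 0 * _ - max (-φ x) 0 * _ = _
  rw [← sub_mul, max_zero_sub_max_neg_zero_eq_self]

/-- The convolution `φ * h` of a compactly supported function (viewed as a density with respect to
Haar measure) with an element of `RUC G`. -/
noncomputable def densityConv : C_c(G, ℝ) →ₗ[ℝ] RUC G →ₗ[ℝ] RUC G :=
  have spec := fun (φ : C_c(G, ℝ)) (h : RUC G) => (exists_densityConv φ h).choose_spec
  LinearMap.mk₂ ℝ (fun φ h => (exists_densityConv φ h).choose)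
    (fun φ ψ h => by
      ext g
      refine (spec _ _ g).trans (Eq.trans ?_ (congrArg₂ (· + ·) (spec φ h g) (spec ψ h g)).symm)
      rw [← integral_add (integrable_density _ (continuous_translates h g))
        (integrable_density _ (continuous_translates h g))]
      simp [add_mul])
    (fun c φ h => by
      ext g
      refine (spec _ _ g).trans (Eq.trans ?_ (congrArg (c * ·) (spec φ h g)).symm)
      simp [mul_assoc, integral_const_mul])
    (fun φ h k => by
      ext g
      refine (spec _ _ g).trans (Eq.trans ?_ (congrArg₂ (· + ·) (spec φ h g) (spec φ k g)).symm)
      rw [← integral_add (integrable_density _ (continuous_translates h g))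
        (integrable_density _ (continuous_translates k g))]
      simp [mul_add])
    (fun c φ h => by
      ext g
      refine (spec _ _ g).trans (Eq.trans ?_ (congrArg (c * ·) (spec φ h g)).symm)
      rw [← integral_const_mul]
      refine integral_congr_ae (Eventually.of_forall fun x => ?_)
      exact mul_left_comm _ _ _)

theorem densityConv_apply (φ : C_c(G, ℝ)) (h : RUC G) (g : G) :
    (densityConv φ h : G →ᵇ ℝ) g = ∫ x, φ x * (h : G →ᵇ ℝ) (x⁻¹ * g) ∂haar :=
  (exists_densityConv φ h).choose_spec g

end Smoothing

/-! ### Translates of densities, domination, and uniqueness of Haar measure -/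

section Translation

open Measure

variable {G : Type*} [Group G] [TopologicalSpace G] [IsTopologicalGroup G]

/-- The left translate `x ↦ φ (g⁻¹ x)` of a compactly supported function. -/
def translateCc (g : G) (φ : C_c(G, ℝ)) : C_c(G, ℝ) :=
  ⟨⟨fun x => φ (g⁻¹ * x), φ.continuous.comp (continuous_const_mul g⁻¹)⟩,
    φ.hasCompactSupport.comp_homeomorph (Homeomorph.mulLeft g⁻¹)⟩

@[simp] theorem translateCc_apply (g : G) (φ : C_c(G, ℝ)) (x : G) :
    translateCc g φ x = φ (g⁻¹ * x) := rfl

/-- A compactly supported function is bounded by a non-negative combination of translates of any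
given non-zero `φ ≥ 0`. -/
theorem exists_abs_le_sum_translates (φ ψ : C_c(G, ℝ)) (hφ : ∀ x, 0 ≤ φ x) {a : G}
    (ha : φ a ≠ 0) : ∃ (n : ℕ) (t : Fin n → ℝ) (g : Fin n → G), (∀ j, 0 ≤ t j) ∧
      ∀ x, |ψ x| ≤ ∑ j, t j * φ ((g j)⁻¹ * x) := by
  have hpos : 0 < φ a := lt_of_le_of_ne (hφ a) ha.symm
  have hK : IsCompact (tsupport ψ) := ψ.hasCompactSupport
  obtain ⟨C, hC⟩ := hK.exists_bound_of_continuousOn ψ.continuous.continuousOn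
  -- The translate of `φ` by `x * a⁻¹` takes the value `φ a` at `x`, so it exceeds `φ a / 2` near
  -- `x`.
  obtain ⟨s, -, hs⟩ := hK.elim_nhds_subcover (fun x => {y | φ a / 2 < φ (a * x⁻¹ * y)})
    fun x _ => by
      have hc : Continuous fun y => φ (a * x⁻¹ * y) :=
        φ.continuous.comp (continuous_const_mul (a * x⁻¹))
      exact (isOpen_lt continuous_const hc).mem_nhds (by simpa using hpos)
  -- The absolute value matters when `tsupport ψ` is empty: `C` may then be negative.
  have ht : 0 ≤ |C| / (φ a / 2) := by positivity
  refine ⟨s.card, fun _ => |C| / (φ a / 2), fun j => (s.equivFin.symm j : G) * a⁻¹,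
    fun _ => ht, fun x => ?_⟩
  have hnn : ∀ y : G, 0 ≤ |C| / (φ a / 2) * φ ((y * a⁻¹)⁻¹ * x) := fun y => mul_nonneg ht (hφ _)
  by_cases hx : x ∈ tsupport ψ
  · obtain ⟨y, hy, hxy⟩ := mem_iUnion₂.1 (hs hx)
    have hxy : φ a / 2 < φ (a * y⁻¹ * x) := hxy
    have h1 := Finset.single_le_sum
      (f := fun j => |C| / (φ a / 2) * φ (((s.equivFin.symm j : G) * a⁻¹)⁻¹ * x))
      (fun j _ => hnn _) (Finset.mem_univ (s.equivFin ⟨y, hy⟩))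
    refine le_trans ?_ h1
    simp only [Equiv.symm_apply_apply, mul_inv_rev, inv_inv]
    calc |ψ x| ≤ |C| := (hC x hx).trans (le_abs_self C)
      _ = |C| / (φ a / 2) * (φ a / 2) := by field_simp
      _ ≤ _ := mul_le_mul_of_nonneg_left hxy.le ht
  · rw [image_eq_zero_of_notMem_tsupport hx, abs_zero]
    exact Finset.sum_nonneg fun j _ => hnn _

variable [T2Space G] [LocallyCompactSpace G] [MeasurableSpace G] [BorelSpace G]

/-- By left invariance of Haar measure. This carries translation invariance from functionals on `RUC
G` over to functionals of the density. -/
theorem densityConv_translateCc (g : G) (φ : C_c(G, ℝ)) (h : RUC G) :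
    densityConv (translateCc g φ) h = translate g (densityConv φ h) := by
  ext z
  change (densityConv (translateCc g φ) h : G →ᵇ ℝ) z = (translate g (densityConv φ h) : G →ᵇ ℝ) z
  rw [translate_apply, densityConv_apply, densityConv_apply, ← integral_mul_left_eq_self _ g]
  simp [mul_assoc]

/-- Uniqueness of Haar measure: an invariant positive functional on compactly supported functions
is a multiple of the Haar integral. -/
theorem exists_eq_mul_integral_haar (Λ : C_c(G, ℝ) →ₗ[ℝ] ℝ) (hpos : ∀ φ, 0 ≤ φ → 0 ≤ Λ φ)
    (hinv : ∀ g φ, Λ (translateCc g φ) = Λ φ) : ∃ c : ℝ, ∀ φ, Λ φ = c * ∫ x, φ x ∂haar := by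
  let ρ := RealRMK.rieszMeasure (PositiveLinearMap.mk₀ Λ hpos)
  have hρ : ∀ φ : C_c(G, ℝ), ∫ x, φ x ∂ρ = Λ φ := RealRMK.integral_rieszMeasure _
  have : ρ.IsMulLeftInvariant := by
    refine ⟨fun g => ?_⟩
    have : (map (g * ·) ρ).Regular := Regular.map (Homeomorph.mulLeft g)
    -- Regular measures are determined by their integrals over `C_c(G)`, and these agree by `hinv`.
    refine ext_of_integral_eq_on_compactlySupported fun φ => ?_
    have hφ : Continuous fun x => φ x := φ.continuous
    rw [integral_map (by fun_prop) hφ.aestronglyMeasurable, hρ, ← hinv g⁻¹ φ, ← hρ]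
    simp
  refine ⟨haarScalarFactor ρ haar, fun φ => ?_⟩
  have hφ : Continuous fun x => φ x := φ.continuous
  rw [← hρ, integral_isMulLeftInvariant_eq_smul_of_hasCompactSupport ρ haar hφ
    φ.hasCompactSupport, integral_smul_nnreal_measure]
  rfl

/-- Smoothing trades domination by a measure for domination by finitely many translates: `|ψ * h| ≤
(|ψ| * μ) * f`, and `θ = |ψ| * μ` lies below a combination of translates of `φ`. -/
theorem densityConv_mem_dominated {f h : RUC G} (hf : ∀ x, 0 ≤ (f : G →ᵇ ℝ) x)
    {φ : C_c(G, ℝ)} (hφ : ∀ x, 0 ≤ φ x) {a : G} (ha : φ a ≠ 0) (ψ : C_c(G, ℝ))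
    (hh : h ∈ measureDominated f) : densityConv ψ h ∈ dominated (densityConv φ f) := by
  obtain ⟨μ, hμ, hle⟩ := hh
  obtain ⟨θ, hθ⟩ := exists_density_conv (ψ ⊔ -ψ) hμ
  obtain ⟨n, t, g, ht, hsum⟩ := exists_abs_le_sum_translates φ θ hφ ha
  have hψ : ∀ x, (ψ ⊔ -ψ) x = |ψ x| := fun x => rfl
  simp only [hψ] at hθ
  refine ⟨n, t, g, ht, fun z => ?_⟩
  have hz := continuous_translates f z
  have hcz : Continuous fun x => (conv μ hμ f : G →ᵇ ℝ) (x⁻¹ * z) := continuous_translates _ z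
  calc |(densityConv ψ h : G →ᵇ ℝ) z|
      ≤ ∫ x, |ψ x * (h : G →ᵇ ℝ) (x⁻¹ * z)| ∂haar := by
        rw [densityConv_apply]
        exact abs_integral_le_integral_abs
    _ ≤ ∫ x, (ψ ⊔ -ψ) x * (conv μ hμ f : G →ᵇ ℝ) (x⁻¹ * z) ∂haar := by
        refine integral_mono (integrable_density ψ (continuous_translates h z)).abs
          (integrable_density _ hcz) fun x => ?_
        simp only [abs_mul, hψ]
        exact mul_le_mul_of_nonneg_left (hle _) (abs_nonneg _)
    _ = ∫ x, θ x * (f : G →ᵇ ℝ) (x⁻¹ * z) ∂haar := by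
        rw [← hθ _ hz]
        simp [hψ, mul_assoc]
    _ ≤ ∫ x, ∑ j, t j * (translateCc (g j) φ x * (f : G →ᵇ ℝ) (x⁻¹ * z)) ∂haar := by
        refine integral_mono (integrable_density θ hz)
          (integrable_finsetSum _ fun j _ => (integrable_density _ hz).const_mul _) fun x => ?_
        simp only [← mul_assoc, ← Finset.sum_mul]
        exact mul_le_mul_of_nonneg_right ((le_abs_self _).trans (hsum x)) (hf _)
    _ = ∑ j, t j * (translate (g j) (densityConv φ f) : G →ᵇ ℝ) z := by
        rw [integral_finsetSum _ fun j _ => (integrable_density _ hz).const_mul _]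
        refine Finset.sum_congr rfl fun j _ => ?_
        rw [integral_const_mul, ← densityConv_translateCc, densityConv_apply]

theorem densityConv_nonneg {φ : C_c(G, ℝ)} (hφ : ∀ x, 0 ≤ φ x) {h : RUC G}
    (hh : ∀ x, 0 ≤ (h : G →ᵇ ℝ) x) (z : G) : 0 ≤ (densityConv φ h : G →ᵇ ℝ) z := by
  rw [densityConv_apply]
  exact integral_nonneg fun x => mul_nonneg (hφ x) (hh _)

theorem densityConv_ne_zero {φ : C_c(G, ℝ)} (hφ : ∀ x, 0 ≤ φ x) {a : G} (ha : φ a ≠ 0)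
    {f : RUC G} (hf : ∀ x, 0 ≤ (f : G →ᵇ ℝ) x) (hf0 : f ≠ 0) : densityConv φ f ≠ 0 := by
  obtain ⟨b, hb⟩ : ∃ b, (f : G →ᵇ ℝ) b ≠ 0 := by
    by_contra! hcon
    exact hf0 (by ext x; exact hcon x)
  intro h0
  -- At the point `a * b` the integrand is continuous, non-negative, and equal to `φ a * f b ≠ 0` at
  -- `x = a`.
  have hz : (densityConv φ f : G →ᵇ ℝ) (a * b) = 0 := by rw [h0]; rfl
  rw [densityConv_apply] at hz
  refine absurd hz (ne_of_gt ?_)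
  refine (φ.continuous.mul (continuous_translates f (a * b)))
    |>.integral_pos_of_hasCompactSupport_nonneg_nonzero (x := a) φ.hasCompactSupport.mul_right
      (fun x => mul_nonneg (hφ x) (hf _)) ?_
  simpa using ⟨ha, hb⟩

theorem conv_add {μ : Measure G} (hμ : IsM00Pos μ) (h k : RUC G) :
    conv μ hμ (h + k) = conv μ hμ h + conv μ hμ k := by
  ext z
  exact integral_add (hμ.integrable (continuous_translates h z))
    (hμ.integrable (continuous_translates k z))

/-- The convolution of a density with a compactly supported probability measure acts on `RUC G` as a
density of the same total mass. -/
theorem exists_densityConv_conv (φ : C_c(G, ℝ)) {μ : Measure G} (hμ : IsM001 μ) :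
    ∃ ψ : C_c(G, ℝ), ∫ x, ψ x ∂haar = ∫ x, φ x ∂haar ∧
      ∀ h : RUC G, densityConv φ (conv μ hμ.toIsM00Pos h) = densityConv ψ h := by
  obtain ⟨ψ, hψ⟩ := exists_density_conv φ hμ.toIsM00Pos
  refine ⟨ψ, ?_, fun h => ?_⟩
  -- Testing against the constant `1` compares total masses, since `μ` has mass one.
  · have h1 := hψ (fun _ => 1) continuous_const
    simpa [measureReal_def, hμ.measure_univ] using h1.symm
  · ext z
    change (densityConv φ _ : G →ᵇ ℝ) z = (densityConv ψ h : G →ᵇ ℝ) z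
    rw [densityConv_apply, densityConv_apply, ← hψ _ (continuous_translates h z)]
    simp [mul_assoc]

end Translation

end NormInt

/-! ### The measurably invariant integral -/

open MeasureTheory NormInt
open scoped BoundedContinuousFunction CompactlySupported

theorem mainTheorem5 (G : Type*) [Group G] [TopologicalSpace G] [IsTopologicalGroup G]
    [T2Space G] [LocallyCompactSpace G] [MeasurableSpace G] [BorelSpace G]
    (h : NormInt.InvariantNormalizedIntegralProperty G) :
    NormInt.MeasurablyInvariantNormalizedIntegralProperty G := by
  intro f hf hf0
  obtain ⟨⟨φ', hφ'⟩, hc, hnn, ha⟩ :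
      ∃ f : C(G, ℝ), HasCompactSupport f ∧ 0 ≤ f ∧ f 1 ≠ 0 := exists_continuous_nonneg_pos 1
  let φ : C_c(G, ℝ) := ⟨⟨φ', hφ'⟩, hc⟩
  have hφ : ∀ x, 0 ≤ φ x := hnn
  have hφ1 : φ 1 ≠ 0 := ha
  obtain ⟨I, hIpos, hIinv, hI1⟩ := h (densityConv φ f) (densityConv_nonneg hφ hf)
    (densityConv_ne_zero hφ hφ1 hf hf0)
  have hmem : ∀ (ψ : C_c(G, ℝ)), ∀ k ∈ measureDominated f,
      densityConv ψ k ∈ dominated (densityConv φ f) :=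
    fun ψ k hk => densityConv_mem_dominated hf hφ hφ1 ψ hk
  let J : measureDominated f →ₗ[ℝ] ℝ := I ∘ₗ (densityConv φ).restrict (hmem φ)
  refine ⟨J, fun k hk => hIpos _ (densityConv_nonneg hφ hk), fun μ hμ k => ?_, hI1⟩
  -- Non-negativity of `k` makes `Λ` below a positive functional, as uniqueness of Haar measure
  -- requires.
  have hnonneg : ∀ k : measureDominated f, (∀ x, 0 ≤ ((k : RUC G) : G →ᵇ ℝ) x) →
      J ⟨conv μ hμ.toIsM00Pos k, conv_mem_measureDominated hμ.toIsM00Pos k.2⟩ = J k := by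
    intro k hk
    let Λ : C_c(G, ℝ) →ₗ[ℝ] ℝ := I ∘ₗ (densityConv.flip (k : RUC G)).codRestrict
      (dominated (densityConv φ f)) fun ψ => hmem ψ k k.2
    have hΛ : ∀ ψ, Λ ψ = I ⟨densityConv ψ k, hmem ψ k k.2⟩ := fun ψ => rfl
    obtain ⟨c, hc⟩ := exists_eq_mul_integral_haar Λ
      (fun ψ hψ => hIpos _ (densityConv_nonneg hψ hk)) fun g ψ => by
        rw [hΛ, hΛ, ← hIinv g ⟨densityConv ψ k, _⟩]
        exact congrArg I (Subtype.ext (densityConv_translateCc g ψ k))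
    obtain ⟨ψ, hψ, hconv⟩ := exists_densityConv_conv φ hμ
    calc J ⟨conv μ hμ.toIsM00Pos k, _⟩ = Λ ψ := congrArg I (Subtype.ext (hconv k))
      _ = Λ φ := by rw [hc, hc, hψ]
      _ = J k := rfl
  -- For arbitrary `k` with `|k| ≤ ν * f`, both `b = ν * f` and `d = b - k` are non-negative
  -- elements of `(E, f)_M`, and additivity gives the claim for `k`.
  obtain ⟨k, hk⟩ := k
  obtain ⟨ν, hν, hle⟩ := id hk
  let b : measureDominated f :=
    ⟨conv ν hν f, conv_mem_measureDominated hν (self_mem_measureDominated hf)⟩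
  have hb : ∀ x, 0 ≤ ((b : RUC G) : G →ᵇ ℝ) x := fun x => (abs_nonneg _).trans (hle x)
  let d : measureDominated f := b + (-1 : ℝ) • ⟨k, hk⟩
  have hd : ∀ x, 0 ≤ ((d : RUC G) : G →ᵇ ℝ) x := fun x => by
    change 0 ≤ (conv ν hν f : G →ᵇ ℝ) x + -1 * (k : G →ᵇ ℝ) x
    linarith [(le_abs_self _).trans (hle x)]
  have hbd : b = d + ⟨k, hk⟩ := by
    ext x
    change (conv ν hν f : G →ᵇ ℝ) x =
      (conv ν hν f : G →ᵇ ℝ) x + -1 * (k : G →ᵇ ℝ) x + (k : G →ᵇ ℝ) x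
    ring
  have hconv : (⟨conv μ hμ.toIsM00Pos b, conv_mem_measureDominated hμ.toIsM00Pos b.2⟩ :
      measureDominated f) = ⟨conv μ hμ.toIsM00Pos d, conv_mem_measureDominated hμ.toIsM00Pos d.2⟩ +
        ⟨conv μ hμ.toIsM00Pos k, conv_mem_measureDominated hμ.toIsM00Pos hk⟩ :=
    Subtype.ext <| by
      rw [hbd]
      exact conv_add hμ.toIsM00Pos d k
  have h1 := hnonneg b hb
  rw [hconv, map_add, hnonneg d hd, (congrArg J hbd).trans (map_add J d _)] at h1
  exact add_left_cancel h1
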